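/- All logarithms are to base $2$, and $h(p)=-p\log p-(1-p)\log(1-p)$ with $0\log 0=0$. Let $G$ be the directed graph with vertices $a,b$ and the four edges $(a,a),(a,b),(b,a),(b,b)$, labeled by $L(a,a)=L(b,a)=1$, $L(a,b)=L(b,b)=0$, and let $f(a,a)=f(b,b)=0$, $f(a,b)=f(b,a)=1$. The product graph $G\times G$ has as vertices the pairs $\langle u,u'\rangle$ of vertices and as edges the pairs $\langle e,e'\rangle$ of edges of $G$ (leading from the pair of initial vertices to the pair of terminal vertices); put $f^{(1)}\langle e,e'\rangle=f(e)$, $f^{(2)}\langle e,e'\rangle=f(e')$, and $\Delta\langle e,e'\rangle=1$ if $L(e)\ne L(e')$ and $0$ otherwise. A stationary Markov chain on a finite directed graph is a function $P$ from its edges to $[0,1]$ with total sum $1$ such that, for every vertex $u$, the sum of $P$ over the edges leaving $u$ equals the sum over the edges entering $u$. Write $\mathbf E_P(g)=\sum_e P(e)g(e)$ and let $H_P(Y|X)$ be the conditional entropy for $\Pr\{X=u,Y=v\}=P((u,v))$ if $(u,v)$ is an edge and $0$ otherwise. For $0\le d\le\frac12$ and $0<\delta\le\frac12$ define $$R_{MA}(d,\delta)=\sup_{p\in[0,d]}\Big\{2\sup_{\substack{P\text{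 on }G\\ \mathbf E_P(f)=p}}H_P(Y|X)-\sup_{\substack{Q\text{ on }G\times G\\ \mathbf E_Q(f^{(1)})=\mathbf E_Q(f^{(2)})=p\\ \mathbf E_Q(\Delta)\in[0,\delta)}}H_Q(Y|X)\Big\},$$ where $P,Q$ range over stationary Markov chains. For $x,z\in\mathbb R$ let $A(x,z)$ be the matrix indexed by the vertices of $G\times G$ whose entry at an edge $\langle e,e'\rangle$ is $2^{-x(f(e)+f(e'))-z\Delta\langle e,e'\rangle}$ (every ordered pair of vertices is an edge), and let $\lambda(x,z)$ be its spectral radius. Theorem. For all $0\le d\le\frac12$ and $0<\delta\le\frac12$, $$R_{MA}(d,\delta)=\sup_{p\in[0,d]}\Big\{2h(p)-\inf_{x\in\mathbb R,\ z\ge0}\big\{2px+\delta z+\log\lambda(x,z)\big\}\Big\}.$$ Moreover, for all $x,z\in\mathbb R$, in the order $\langle a,a\rangle,\langle a,b\rangle,\langle b,a\rangle,\langle b,b\rangle$ of the vertices, $$A(x,z)=\begin{pmatrix}1&2^{-x-z}&2^{-x-z}&2^{-2x}\\2^{-x}&2^{-z}&2^{-2x-z}&2^{-x}\\2^{-x}&2^{-2x-z}&2^{-z}&2^{-x}\\2^{-2x}&2^{-x-z}&2^{-x-z}&1\end{pmatrix},$$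 $$\lambda(x,z)=\tfrac12\Big((4^{-x}+1)(2^{-z}+1)+\sqrt{(4^{-x}+1)^2\,4^{-z}-2(16^{-x}-6\cdot4^{-x}+1)2^{-z}+(4^{-x}+1)^2}\Big).$$ -/

import Mathlib

open scoped Matrix BigOperators

noncomputable section

namespace MarkovBound

/-- A finite directed graph with vertex set `V` and edge set `E`. As an edge is the pair of its
initial and terminal vertices, there are no parallel edges (loops are allowed). -/
structure DiGraph (V E : Type) where
  src : E → V
  tgt : E → V
  edge_ext : ∀ e e' : E, src e = src e' → tgt e = tgt e' → e = e'

/-- A labeled directed graph over the alphabet `S`. -/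
structure LabeledGraph (V E S : Type) extends DiGraph V E where
  label : E → S

/-- The product graph `G × H`: its vertices are pairs of vertices, its edges pairs of edges. -/
def DiGraph.prod {V E W F : Type} (G : DiGraph V E) (H : DiGraph W F) :
    DiGraph (V × W) (E × F) where
  src e := (G.src e.1, H.src e.2)
  tgt e := (G.tgt e.1, H.tgt e.2)
  edge_ext := by
    rintro ⟨e₁, e₂⟩ ⟨e₁', e₂'⟩ hs ht
    simp only [Prod.mk.injEq] at hs ht ⊢
    exact ⟨G.edge_ext _ _ hs.1 ht.1, H.edge_ext _ _ hs.2 ht.2⟩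

section Chains

variable {V E : Type} [Fintype V] [DecidableEq V] [Fintype E]

/-- Stationary Markov chains on `G`: functions `P : E → [0,1]` of total mass one such that the
mass leaving each vertex equals the mass entering it. -/
def IsStationaryChain (G : DiGraph V E) (P : E → ℝ) : Prop :=
  (∀ e, P e ∈ Set.Icc (0 : ℝ) 1) ∧
  (∑ e, P e = 1) ∧
  ∀ u, (∑ e with G.src e = u, P e) = ∑ e with G.tgt e = u, P e

/-- The expected value `E_P(f) = ∑ P(e) f(e)`, for `f` with values in a real vector space. -/
def expect {M : Type} [AddCommGroup M] [Module ℝ M] (P : E → ℝ) (f : E → M) : M :=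
  ∑ e, P e • f e

/-- The stationary Markov chains `P` on `G` with `E_P(f) ∈ U`. -/
def chains {M : Type} [AddCommGroup M] [Module ℝ M] (G : DiGraph V E) (f : E → M) (U : Set M) :
    Set (E → ℝ) :=
  {P | IsStationaryChain G P ∧ expect P f ∈ U}

/-- The joint law `Pr{X = u, Y = v}`: it is `P(e)` if `e` is the (only) edge from `u` to `v`,
and `0` if there is no such edge. -/
def joint (G : DiGraph V E) (P : E → ℝ) (u v : V) : ℝ :=
  ∑ e with G.src e = u ∧ G.tgt e = v, P e

/-- The conditional entropy `H_P(Y|X) = - ∑ Pr{X=u,Y=v} log₂ (Pr{X=u,Y=v} / Pr{X=u})`. -/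
def condEntropy (G : DiGraph V E) (P : E → ℝ) : ℝ :=
  -∑ u, ∑ v, joint G P u v * Real.logb 2 (joint G P u v / ∑ w, joint G P u w)

/-- The supremum of `H_P(Y|X)` over the stationary Markov chains with `E_P(f) ∈ U`
(in the extended reals, so that it is `-∞` if there are none). -/
def maxEntropy {M : Type} [AddCommGroup M] [Module ℝ M] (G : DiGraph V E) (f : E → M)
    (U : Set M) : EReal :=
  ⨆ P ∈ chains G f U, (condEntropy G P : EReal)

/-- The matrix `A_{G;f}(x)`: its `(u,v)` entry is `2^(-x·f(e))` if `e` is the (only) edge from `u`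
to `v`, and `0` if there is no such edge. -/
def weightMatrix {k : ℕ} (G : DiGraph V E) (f : E → Fin k → ℝ) (x : Fin k → ℝ) : Matrix V V ℝ :=
  Matrix.of fun u v => ∑ e with G.src e = u ∧ G.tgt e = v, (2 : ℝ) ^ (-(x ⬝ᵥ f e))

end Chains

/-- The spectral radius of a real square matrix: the largest modulus of a complex eigenvalue. -/
def matrixSpectralRadius {V : Type} [Fintype V] [DecidableEq V] (A : Matrix V V ℝ) : ℝ :=
  (spectralRadius ℂ (A.map (fun r : ℝ => (r : ℂ)))).toReal

/-- The graph `G` with vertices `a = 0`, `b = 1` and all four edges `(a,a), (a,b), (b,a), (b,b)`;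
edges into `a` are labeled `1`, and edges into `b` are labeled `0`. -/
def graphG : LabeledGraph (Fin 2) (Fin 2 × Fin 2) (Fin 2) where
  src e := e.1
  tgt e := e.2
  edge_ext := fun _ _ hs ht => Prod.ext hs ht
  label e := if e.2 = 0 then 1 else 0

/-- The graph `G × G`. -/
def graphGG : DiGraph (Fin 2 × Fin 2) ((Fin 2 × Fin 2) × (Fin 2 × Fin 2)) :=
  graphG.toDiGraph.prod graphG.toDiGraph

/-- The switch function `f` on the edges of `G`: `f(a,a) = f(b,b) = 0`, `f(a,b) = f(b,a) = 1`. -/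
def switchFn (e : Fin 2 × Fin 2) : ℝ := if e.1 = e.2 then 0 else 1

/-- `Δ⟨e,e'⟩` is `1` if the labels of `e` and `e'` differ, and `0` otherwise. -/
def labelDist (e : (Fin 2 × Fin 2) × (Fin 2 × Fin 2)) : ℝ :=
  if graphG.label e.1 ≠ graphG.label e.2 then 1 else 0

/-- `φ = [f⁽¹⁾, f⁽²⁾, Δ]`, with `f⁽¹⁾⟨e,e'⟩ = f(e)` and `f⁽²⁾⟨e,e'⟩ = f(e')`. -/
def phi (e : (Fin 2 × Fin 2) × (Fin 2 × Fin 2)) : ℝ × ℝ × ℝ :=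
  (switchFn e.1, switchFn e.2, labelDist e)

/-- `φ' = [f⁽¹⁾ + f⁽²⁾, Δ]`. -/
def phi' (e : (Fin 2 × Fin 2) × (Fin 2 × Fin 2)) : Fin 2 → ℝ :=
  ![switchFn e.1 + switchFn e.2, labelDist e]

/-- `F(U)`: the supremum of `H_P(Y|X)` over the stationary chains `P` on `G` with
`E_P(f) ∈ U`. -/
def calF (U : Set ℝ) : EReal := maxEntropy graphG.toDiGraph switchFn U

/-- `G(U,δ)`: the supremum of `H_Q(Y|X)` over the stationary chains `Q` on `G × G` with
`E_Q(φ) ∈ U × U × [0,δ)`. -/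
def calG (U : Set ℝ) (δ : ℝ) : EReal := maxEntropy graphGG phi (U ×ˢ U ×ˢ Set.Ico 0 δ)

/-- `R_MA(d,δ) = sup_{p ∈ [0,d]} (2 F({p}) - G({p},δ))`. -/
def RMA (d δ : ℝ) : EReal := ⨆ p ∈ Set.Icc (0 : ℝ) d, (2 * calF {p} - calG {p} δ)

/-- The matrix `A_{G×G;φ'}(x,z)`. -/
def matrixA (x z : ℝ) : Matrix (Fin 2 × Fin 2) (Fin 2 × Fin 2) ℝ :=
  weightMatrix graphGG phi' ![x, z]

/-- The spectral radius `λ_{G×G;φ'}(x,z)` of `A_{G×G;φ'}(x,z)`. -/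
def lam (x z : ℝ) : ℝ := matrixSpectralRadius (matrixA x z)

/-- The binary entropy function, with logarithms to base 2 (`Real.binEntropy` is in nats). -/
def binEnt (p : ℝ) : ℝ := Real.binEntropy p / Real.log 2

end MarkovBound

end

open MarkovBound

set_option linter.unusedSectionVars false

namespace MarkovBound

/-! ### Conditional entropy of stationary chains -/

section Chains

variable {V E : Type} [Fintype V] [DecidableEq V] [Fintype E] {G : DiGraph V E} {P Q : E → ℝ}

/-! The identity holds for each `p ≤ 1/2` separately. The supremum over chains on `G` is `h(p)`, by
Gibbs' inequality (`calF_eq`). The supremum over chains on `G × G` is a concave maximisation under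
linear constraints, and it equals its Lagrangian dual `inf (2px + δz + log λ)` (`calG_eq`).

Weak duality is Gibbs' inequality `condEntropy_le` for the kernel `A u v * r v / (μ * r u)` of a
positive eigenvector `r`; the contributions of `r` cancel along a stationary chain. Equality holds
for the chain built from left and right eigenvectors (`condEntropy_perronChain`). These are
explicit, since `A` respects the partition of the vertices into diagonal and off-diagonal ones and
so reduces to a 2 × 2 matrix.

No derivative of `λ` is needed: weak duality shows that minus the expectations under the equality
chain form a subgradient of `log λ`, and they are continuous in `(x, z)`. Hence the chain at a
minimiser of the dual satisfies the first order conditions (`expect_dualChain_of_min`). Its symmetry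
under swapping the two components splits `E(f⁽¹⁾ + f⁽²⁾) = 2p` evenly, so it attains the dual value.
Two boundary effects remain: `E(Δ) = δ` is excluded by `[0,δ)`, which costs nothing in the supremum
(`coe_le_calG`), and for `p = 0` the dual infimum is not attained. -/

theorem DiGraph.sum_edge (G : DiGraph V E) {M : Type*} [AddCommMonoid M] (g : E → M) (e : E) :
    ∑ e' with G.src e' = G.src e ∧ G.tgt e' = G.tgt e, g e' = g e := by
  rw [Finset.sum_eq_single e]
  · intro b hb hne
    simp only [Finset.mem_filter, Finset.mem_univ, true_and] at hb
    exact absurd (G.edge_ext _ _ hb.1 hb.2) hne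
  · simp

theorem joint_edge (G : DiGraph V E) (P : E → ℝ) (e : E) :
    joint G P (G.src e) (G.tgt e) = P e :=
  G.sum_edge P e

theorem sum_joint_mul (G : DiGraph V E) (P : E → ℝ) (c : V → V → ℝ) :
    ∑ u, ∑ v, joint G P u v * c u v = ∑ e, P e * c (G.src e) (G.tgt e) := by
  rw [← Finset.sum_fiberwise (s := Finset.univ) (g := G.src)]
  refine Finset.sum_congr rfl fun u _ => ?_
  rw [← Finset.sum_fiberwise (g := G.tgt)]
  refine Finset.sum_congr rfl fun v _ => ?_
  rw [joint, Finset.sum_mul, Finset.filter_filter]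
  refine Finset.sum_congr rfl fun e he => ?_
  simp only [Finset.mem_filter, Finset.mem_univ, true_and] at he
  rw [he.1, he.2]

theorem sum_joint (G : DiGraph V E) (P : E → ℝ) (u : V) :
    ∑ w, joint G P u w = ∑ e with G.src e = u, P e := by
  rw [← Finset.sum_fiberwise (g := G.tgt)]
  refine Finset.sum_congr rfl fun v _ => ?_
  rw [joint, Finset.filter_filter]

theorem joint_nonneg (hP : ∀ e, 0 ≤ P e) (u v : V) : 0 ≤ joint G P u v :=
  Finset.sum_nonneg fun e _ => hP e

theorem condEntropy_eq (G : DiGraph V E) (P : E → ℝ) :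
    condEntropy G P =
      -∑ e, P e * Real.logb 2 (P e / ∑ e' with G.src e' = G.src e, P e') := by
  rw [condEntropy, sum_joint_mul G P fun u v => Real.logb 2 (joint G P u v / ∑ w, joint G P u w)]
  simp only [joint_edge, sum_joint]

theorem le_sum_src (hP : ∀ e, 0 ≤ P e) (e : E) : P e ≤ ∑ e' with G.src e' = G.src e, P e' :=
  Finset.single_le_sum (f := P) (fun i _ => hP i) (by simp)

theorem condEntropy_nonneg (hP : ∀ e, 0 ≤ P e) : 0 ≤ condEntropy G P := by
  rw [condEntropy_eq, neg_nonneg]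
  refine Finset.sum_nonpos fun e _ => mul_nonpos_of_nonneg_of_nonpos (hP e) ?_
  have h := le_sum_src (G := G) hP e
  have h0 := (hP e).trans h
  exact Real.logb_nonpos (by norm_num) (div_nonneg (hP e) h0) (div_le_one_of_le₀ h h0)

/-- This is `log t ≤ t - 1` at `t = π q / j`, multiplied by `j`. Summed over a row, the right side
becomes `π (∑ q - 1) ≤ 0`, which is Gibbs' inequality. -/
theorem mul_log_sub_le {j π q : ℝ} (hj : 0 ≤ j) (hjπ : j ≤ π) (hq : 0 ≤ q)
    (h : j ≠ 0 → q ≠ 0) : j * Real.log q - j * Real.log (j / π) ≤ π * q - j := by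
  rcases hj.eq_or_lt with rfl | hj
  · simpa using mul_nonneg hjπ hq
  have hπ : 0 < π := hj.trans_le hjπ
  have hq : 0 < q := lt_of_le_of_ne hq (h hj.ne').symm
  have key := Real.log_le_sub_one_of_pos (show 0 < π * q / j by positivity)
  have e : Real.log (π * q / j) = Real.log q - Real.log (j / π) := by
    rw [Real.log_div (by positivity) hj.ne', Real.log_mul hπ.ne' hq.ne',
      Real.log_div hj.ne' hπ.ne']
    ring
  calc j * Real.log q - j * Real.log (j / π) = j * Real.log (π * q / j) := by rw [e]; ring
    _ ≤ j * (π * q / j - 1) := by gcongr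
    _ = π * q - j := by field_simp

/-- Gibbs' inequality: the conditional entropy is at most the cross entropy with respect to any
(sub)stochastic kernel. -/
theorem condEntropy_le (hP : ∀ e, 0 ≤ P e) (q : V → V → ℝ) (hq : ∀ u v, 0 ≤ q u v)
    (hq1 : ∀ u, ∑ v, q u v ≤ 1) (hPq : ∀ e, P e ≠ 0 → q (G.src e) (G.tgt e) ≠ 0) :
    condEntropy G P ≤ -∑ e, P e * Real.logb 2 (q (G.src e) (G.tgt e)) := by
  have hjq : ∀ u v, joint G P u v ≠ 0 → q u v ≠ 0 := by
    intro u v h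
    obtain ⟨e, he, hne⟩ := Finset.exists_ne_zero_of_sum_ne_zero h
    simp only [Finset.mem_filter, Finset.mem_univ, true_and] at he
    rw [← he.1, ← he.2]
    exact hPq e hne
  have key : ∑ u, ∑ v, (joint G P u v * Real.log (q u v) -
      joint G P u v * Real.log (joint G P u v / ∑ w, joint G P u w)) ≤ 0 := by
    refine Finset.sum_nonpos fun u _ => ?_
    calc _ ≤ ∑ v, ((∑ w, joint G P u w) * q u v - joint G P u v) :=
          Finset.sum_le_sum fun v _ => mul_log_sub_le (joint_nonneg hP u v)
            (Finset.single_le_sum (f := joint G P u) (fun i _ => joint_nonneg hP u i)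
              (Finset.mem_univ v)) (hq u v) (hjq u v)
      _ = (∑ w, joint G P u w) * (∑ v, q u v - 1) := by
          rw [Finset.sum_sub_distrib, ← Finset.mul_sum]; ring
      _ ≤ 0 := mul_nonpos_of_nonneg_of_nonpos
          (Finset.sum_nonneg fun v _ => joint_nonneg hP u v) (by linarith [hq1 u])
  rw [condEntropy, ← sum_joint_mul G P fun u v => Real.logb 2 (q u v), neg_le_neg_iff,
    ← sub_nonpos]
  have hlog : (0 : ℝ) < Real.log 2 := Real.log_pos (by norm_num)
  simp only [← Finset.sum_sub_distrib] at key ⊢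
  calc _ = (∑ u, ∑ v, (joint G P u v * Real.log (q u v) -
      joint G P u v * Real.log (joint G P u v / ∑ w, joint G P u w))) / Real.log 2 := by
        simp only [Finset.sum_div, Real.logb]
        refine Finset.sum_congr rfl fun u _ => Finset.sum_congr rfl fun v _ => by ring
    _ ≤ 0 := div_nonpos_of_nonpos_of_nonneg key hlog.le

/-- Cross entropy against the fixed transition kernel of the mixture is linear in the chain, bounds
the entropies of `P` and `Q` from above, and is exact for the mixture. Positivity of `s` and `t`
keeps both supports inside that of the mixture. -/
theorem condEntropy_concave (hP : ∀ e, 0 ≤ P e) (hQ : ∀ e, 0 ≤ Q e) {s t : ℝ} (hs : 0 < s)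
    (ht : 0 < t) :
    s * condEntropy G P + t * condEntropy G Q ≤ condEntropy G (fun e => s * P e + t * Q e) := by
  set R : E → ℝ := fun e => s * P e + t * Q e with hR
  have hR0 : ∀ e, 0 ≤ R e := fun e => by have := hP e; have := hQ e; positivity
  set q : V → V → ℝ := fun u v => joint G R u v / ∑ w, joint G R u w with hq
  have hq0 : ∀ u v, 0 ≤ q u v := fun u v =>
    div_nonneg (joint_nonneg hR0 u v) (Finset.sum_nonneg fun w _ => joint_nonneg hR0 u w)
  have hq1 : ∀ u, ∑ v, q u v ≤ 1 := fun u => by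
    rw [← Finset.sum_div]; exact div_self_le_one _
  have hRq : ∀ e, R e ≠ 0 → q (G.src e) (G.tgt e) ≠ 0 := fun e he => by
    have h1 : 0 < R e := lt_of_le_of_ne (hR0 e) he.symm
    have h2 := h1.trans_le (le_sum_src (G := G) hR0 e)
    simp only [hq, joint_edge, sum_joint]
    positivity
  have hP1 := condEntropy_le (G := G) hP q hq0 hq1 fun e he => hRq e (by
    have := lt_of_le_of_ne (hP e) he.symm
    have := hQ e
    simp only [hR]; positivity)
  have hQ1 := condEntropy_le (G := G) hQ q hq0 hq1 fun e he => hRq e (by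
    have := lt_of_le_of_ne (hQ e) he.symm
    have := hP e
    simp only [hR]; positivity)
  have hR1 : condEntropy G R = -∑ e, R e * Real.logb 2 (q (G.src e) (G.tgt e)) := by
    rw [condEntropy_eq]; simp only [hq, joint_edge, sum_joint]
  have hsum : -∑ e, R e * Real.logb 2 (q (G.src e) (G.tgt e)) =
      s * (-∑ e, P e * Real.logb 2 (q (G.src e) (G.tgt e))) +
      t * (-∑ e, Q e * Real.logb 2 (q (G.src e) (G.tgt e))) := by
    simp only [hR, add_mul, Finset.sum_add_distrib, mul_assoc, ← Finset.mul_sum]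
    ring
  rw [hR1, hsum]
  gcongr

theorem IsStationaryChain.nonneg (hP : IsStationaryChain G P) (e : E) : 0 ≤ P e := (hP.1 e).1

theorem isStationaryChain_of_nonneg (h0 : ∀ e, 0 ≤ P e) (h1 : ∑ e, P e = 1)
    (h : ∀ u, (∑ e with G.src e = u, P e) = ∑ e with G.tgt e = u, P e) :
    IsStationaryChain G P :=
  ⟨fun e => ⟨h0 e, h1 ▸ Finset.single_le_sum (f := P) (fun i _ => h0 i) (Finset.mem_univ e)⟩,
    h1, h⟩

theorem IsStationaryChain.mix (hP : IsStationaryChain G P) (hQ : IsStationaryChain G Q) {s t : ℝ}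
    (hs : 0 ≤ s) (ht : 0 ≤ t) (hst : s + t = 1) :
    IsStationaryChain G (fun e => s * P e + t * Q e) := by
  refine isStationaryChain_of_nonneg (fun e => ?_) ?_ fun u => ?_
  · have := hP.nonneg e; have := hQ.nonneg e; positivity
  · rw [Finset.sum_add_distrib, ← Finset.mul_sum, ← Finset.mul_sum, hP.2.1, hQ.2.1]
    linarith
  · simp only [Finset.sum_add_distrib, ← Finset.mul_sum, hP.2.2 u, hQ.2.2 u]

theorem sum_mul_comp_src (G : DiGraph V E) (P : E → ℝ) (c : V → ℝ) :
    ∑ e, P e * c (G.src e) = ∑ u, (∑ e with G.src e = u, P e) * c u := by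
  rw [← Finset.sum_fiberwise (s := Finset.univ) (g := G.src)]
  refine Finset.sum_congr rfl fun u _ => ?_
  rw [Finset.sum_mul]
  refine Finset.sum_congr rfl fun e he => ?_
  rw [(Finset.mem_filter.1 he).2]

theorem sum_mul_comp_tgt (G : DiGraph V E) (P : E → ℝ) (c : V → ℝ) :
    ∑ e, P e * c (G.tgt e) = ∑ u, (∑ e with G.tgt e = u, P e) * c u := by
  rw [← Finset.sum_fiberwise (s := Finset.univ) (g := G.tgt)]
  refine Finset.sum_congr rfl fun u _ => ?_
  rw [Finset.sum_mul]
  refine Finset.sum_congr rfl fun e he => ?_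
  rw [(Finset.mem_filter.1 he).2]

theorem IsStationaryChain.sum_mul_comp (hP : IsStationaryChain G P) (c : V → ℝ) :
    ∑ e, P e * c (G.src e) = ∑ e, P e * c (G.tgt e) := by
  rw [sum_mul_comp_src, sum_mul_comp_tgt]
  exact Finset.sum_congr rfl fun u _ => by rw [hP.2.2 u]

/-! ### Weight matrices, weak duality and the equality chain -/

section Weights

variable {k : ℕ} {f : E → Fin k → ℝ} {x : Fin k → ℝ} {l r : V → ℝ} {μ : ℝ}

theorem weightMatrix_edge (G : DiGraph V E) (f : E → Fin k → ℝ) (x : Fin k → ℝ) (e : E) :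
    weightMatrix G f x (G.src e) (G.tgt e) = 2 ^ (-(x ⬝ᵥ f e)) := by
  simp only [weightMatrix, Matrix.of_apply]
  exact G.sum_edge (fun e' => (2 : ℝ) ^ (-(x ⬝ᵥ f e'))) e

theorem weightMatrix_nonneg (G : DiGraph V E) (f : E → Fin k → ℝ) (x : Fin k → ℝ) (u v : V) :
    0 ≤ weightMatrix G f x u v := by
  simp only [weightMatrix, Matrix.of_apply]
  positivity

theorem weightMatrix_mulVec (G : DiGraph V E) (f : E → Fin k → ℝ) (x : Fin k → ℝ) (r : V → ℝ)
    (u : V) : (weightMatrix G f x *ᵥ r) u =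
      ∑ e with G.src e = u, 2 ^ (-(x ⬝ᵥ f e)) * r (G.tgt e) := by
  rw [← Finset.sum_fiberwise (g := G.tgt)]
  refine Finset.sum_congr rfl fun v _ => ?_
  simp only [weightMatrix, Matrix.of_apply]
  rw [Finset.sum_mul, Finset.filter_filter]
  refine Finset.sum_congr rfl fun e he => ?_
  rw [(Finset.mem_filter.1 he).2.2]

theorem vecMul_weightMatrix (G : DiGraph V E) (f : E → Fin k → ℝ) (x : Fin k → ℝ) (l : V → ℝ)
    (v : V) : (l ᵥ* weightMatrix G f x) v =
      ∑ e with G.tgt e = v, l (G.src e) * 2 ^ (-(x ⬝ᵥ f e)) := by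
  rw [← Finset.sum_fiberwise (g := G.src)]
  refine Finset.sum_congr rfl fun u _ => ?_
  simp only [weightMatrix, Matrix.of_apply]
  rw [Finset.mul_sum, Finset.filter_filter]
  refine Finset.sum_congr (by ext; simp [and_comm]) fun e he => ?_
  rw [(Finset.mem_filter.1 he).2.2]

theorem expect_dotProduct (P : E → ℝ) (f : E → Fin k → ℝ) (x : Fin k → ℝ) :
    x ⬝ᵥ expect P f = ∑ e, P e * (x ⬝ᵥ f e) := by
  simp [expect, dotProduct_sum, dotProduct_smul]

/-- Cross entropy of a stationary chain with respect to the kernel obtained from a positive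
right eigenvector of the weight matrix. -/
theorem IsStationaryChain.sum_logb_kernel (hP : IsStationaryChain G P) (hr : ∀ u, 0 < r u)
    (hμ : 0 < μ) :
    -∑ e, P e * Real.logb 2 (2 ^ (-(x ⬝ᵥ f e)) * r (G.tgt e) / (μ * r (G.src e))) =
      x ⬝ᵥ expect P f + Real.logb 2 μ := by
  have h : ∀ e, P e * Real.logb 2 (2 ^ (-(x ⬝ᵥ f e)) * r (G.tgt e) / (μ * r (G.src e))) =
      -(P e * (x ⬝ᵥ f e)) + P e * Real.logb 2 (r (G.tgt e)) - P e * Real.logb 2 μ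
        - P e * Real.logb 2 (r (G.src e)) := by
    intro e
    have h1 := hr (G.tgt e)
    have h2 := hr (G.src e)
    rw [Real.logb_div (by positivity) (by positivity), Real.logb_mul (by positivity) h1.ne',
      Real.logb_mul hμ.ne' h2.ne', Real.logb_rpow (by norm_num) (by norm_num)]
    ring
  simp only [h, Finset.sum_add_distrib, Finset.sum_sub_distrib, Finset.sum_neg_distrib]
  -- By stationarity both endpoints of an edge have the same law, so the two `log r` sums cancel.
  rw [← Finset.sum_mul, hP.2.1, expect_dotProduct,
    hP.sum_mul_comp fun u => Real.logb 2 (r u)]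
  ring

/-- Weak duality: the conditional entropy is bounded through any positive eigenvector of the
weight matrix. -/
theorem IsStationaryChain.condEntropy_le_logb (hP : IsStationaryChain G P) (hr : ∀ u, 0 < r u)
    (hμ : 0 < μ) (h : weightMatrix G f x *ᵥ r = μ • r) :
    condEntropy G P ≤ x ⬝ᵥ expect P f + Real.logb 2 μ := by
  -- The rows of this kernel sum to one because `r` is an eigenvector for `μ`.
  have key := condEntropy_le (G := G) hP.nonneg
    (fun u v => weightMatrix G f x u v * r v / (μ * r u))
    (fun u v => div_nonneg (mul_nonneg (weightMatrix_nonneg G f x u v) (hr v).le)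
      (mul_pos hμ (hr u)).le)
    (fun u => by
      have := congrFun h u
      rw [← Finset.sum_div, div_le_one (mul_pos hμ (hr u))]
      exact this.le)
    (fun e _ => by
      have h1 := hr (G.tgt e)
      have h2 := hr (G.src e)
      simp only [weightMatrix_edge]
      positivity)
  simp only [weightMatrix_edge] at key
  rwa [hP.sum_logb_kernel hr hμ] at key

/-- The stationary chain built from left and right eigenvectors `l`, `r` of the weight matrix for
the eigenvalue `μ`. -/
noncomputable def perronChain (G : DiGraph V E) (f : E → Fin k → ℝ) (x : Fin k → ℝ) (l r : V → ℝ)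
    (μ : ℝ) (e : E) : ℝ :=
  l (G.src e) * 2 ^ (-(x ⬝ᵥ f e)) * r (G.tgt e) / (μ * (l ⬝ᵥ r))

/-- The eigenvector equation for `r` collapses the outgoing mass; the one for `l` gives the same
value for the incoming mass, whence stationarity. -/
theorem sum_src_perronChain (h : weightMatrix G f x *ᵥ r = μ • r) (hμ : μ ≠ 0) (u : V) :
    ∑ e with G.src e = u, perronChain G f x l r μ e = l u * r u / (l ⬝ᵥ r) := by
  have h1 : ∑ e with G.src e = u, perronChain G f x l r μ e =
      l u * (weightMatrix G f x *ᵥ r) u / (μ * (l ⬝ᵥ r)) := by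
    rw [weightMatrix_mulVec, Finset.mul_sum, Finset.sum_div]
    refine Finset.sum_congr rfl fun e he => ?_
    rw [perronChain, (Finset.mem_filter.1 he).2, mul_assoc]
  rw [h1, h, Pi.smul_apply, smul_eq_mul, mul_left_comm, mul_div_mul_left _ _ hμ]

theorem sum_tgt_perronChain (h : l ᵥ* weightMatrix G f x = μ • l) (hμ : μ ≠ 0) (u : V) :
    ∑ e with G.tgt e = u, perronChain G f x l r μ e = l u * r u / (l ⬝ᵥ r) := by
  have h1 : ∑ e with G.tgt e = u, perronChain G f x l r μ e =
      (l ᵥ* weightMatrix G f x) u * r u / (μ * (l ⬝ᵥ r)) := by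
    rw [vecMul_weightMatrix, Finset.sum_mul, Finset.sum_div]
    refine Finset.sum_congr rfl fun e he => ?_
    rw [perronChain, (Finset.mem_filter.1 he).2]
  rw [h1, h, Pi.smul_apply, smul_eq_mul, mul_assoc, mul_div_mul_left _ _ hμ]

theorem isStationaryChain_perronChain [Nonempty V] (hl : ∀ u, 0 < l u) (hr : ∀ u, 0 < r u)
    (hμ : 0 < μ) (hA : weightMatrix G f x *ᵥ r = μ • r) (hA' : l ᵥ* weightMatrix G f x = μ • l) :
    IsStationaryChain G (perronChain G f x l r μ) := by
  have hlr : 0 < l ⬝ᵥ r :=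
    Finset.sum_pos (fun u _ => mul_pos (hl u) (hr u)) Finset.univ_nonempty
  refine isStationaryChain_of_nonneg (fun e => ?_) ?_ fun u => ?_
  · have := hl (G.src e); have := hr (G.tgt e)
    rw [perronChain]; positivity
  · rw [← Finset.sum_fiberwise (s := Finset.univ) (g := G.src)]
    simp only [sum_src_perronChain hA hμ.ne']
    rw [← Finset.sum_div]
    exact div_self hlr.ne'
  · rw [sum_src_perronChain hA hμ.ne', sum_tgt_perronChain hA' hμ.ne']

/-- The transition probabilities of this chain are exactly the kernel used in weak duality, so
Gibbs' inequality is an equality. -/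
theorem condEntropy_perronChain [Nonempty V] (hl : ∀ u, 0 < l u) (hr : ∀ u, 0 < r u)
    (hμ : 0 < μ) (hA : weightMatrix G f x *ᵥ r = μ • r) (hA' : l ᵥ* weightMatrix G f x = μ • l) :
    condEntropy G (perronChain G f x l r μ) =
      x ⬝ᵥ expect (perronChain G f x l r μ) f + Real.logb 2 μ := by
  have hlr : 0 < l ⬝ᵥ r :=
    Finset.sum_pos (fun u _ => mul_pos (hl u) (hr u)) Finset.univ_nonempty
  rw [← (isStationaryChain_perronChain hl hr hμ hA hA').sum_logb_kernel hr hμ, condEntropy_eq]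
  congr 1
  refine Finset.sum_congr rfl fun e _ => ?_
  rw [sum_src_perronChain hA hμ.ne']
  congr 2
  have := hl (G.src e); have := hr (G.src e)
  rw [perronChain]
  field_simp

end Weights

end Chains

/-! ### The spectral radius and explicit eigenvectors -/

/-- A positive eigenvector of an entrywise nonnegative matrix belongs to the spectral radius. -/
theorem matrixSpectralRadius_eq {V : Type} [Fintype V] [DecidableEq V] [Nonempty V]
    {A : Matrix V V ℝ} {r : V → ℝ} {μ : ℝ} (hA : ∀ u v, 0 ≤ A u v) (hr : ∀ u, 0 < r u)
    (hμ : 0 ≤ μ) (h : A *ᵥ r = μ • r) : matrixSpectralRadius A = μ := by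
  set B : Matrix V V ℂ := A.map (fun t : ℝ => (t : ℂ)) with hB
  have hspec : ∀ z : ℂ, z ∈ spectrum ℂ B ↔ ∃ v : V → ℂ, v ≠ 0 ∧ B *ᵥ v = z • v := by
    intro z
    rw [← Matrix.spectrum_toLin', ← Module.End.hasEigenvalue_iff_mem_spectrum]
    constructor
    · intro hz
      obtain ⟨v, hv⟩ := hz.exists_hasEigenvector
      exact ⟨v, hv.2, by simpa using hv.apply_eq_smul⟩
    · rintro ⟨v, hv, hvz⟩
      exact Module.End.hasEigenvalue_of_hasEigenvector
        (x := v) ⟨Module.End.mem_eigenspace_iff.2 (by simpa using hvz), hv⟩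
  have hle : ∀ z ∈ spectrum ℂ B, ‖z‖ ≤ μ := by
    intro z hz
    obtain ⟨v, hv, hvz⟩ := (hspec z).1 hz
    -- At a vertex maximising `‖v u‖ / r u`, the eigenvector equation for `v` is dominated by the
    -- one for `r`.
    obtain ⟨u, hu⟩ := Finite.exists_max fun u => ‖v u‖ / r u
    have hpos : 0 < ‖v u‖ / r u := by
      obtain ⟨w, hw⟩ := Function.ne_iff.1 hv
      exact (div_pos (norm_pos_iff.2 hw) (hr w)).trans_le (hu w)
    have hvu : 0 < ‖v u‖ := by
      by_contra hc
      rw [le_antisymm (not_lt.1 hc) (norm_nonneg _), zero_div] at hpos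
      exact hpos.false
    have h1 : ‖z‖ * ‖v u‖ ≤ μ * ‖v u‖ := by
      have e1 := congrFun hvz u
      have e2 : (∑ w, A u w * r w) = μ * r u := congrFun h u
      calc ‖z‖ * ‖v u‖ = ‖(B *ᵥ v) u‖ := by rw [e1, Pi.smul_apply, smul_eq_mul, norm_mul]
        _ ≤ ∑ w, ‖B u w * v w‖ := norm_sum_le _ _
        _ ≤ ∑ w, (‖v u‖ / r u) * (A u w * r w) := by
          refine Finset.sum_le_sum fun w _ => ?_
          rw [norm_mul, hB, Matrix.map_apply, Complex.norm_real, Real.norm_of_nonneg (hA u w)]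
          have := (div_le_iff₀ (hr w)).1 (hu w)
          nlinarith [hA u w]
        _ = μ * ‖v u‖ := by
          rw [← Finset.mul_sum, e2]
          have := (hr u).ne'
          field_simp
    exact le_of_mul_le_mul_right h1 hvu
  have hmem : (μ : ℂ) ∈ spectrum ℂ B := by
    refine (hspec _).2 ⟨fun u => (r u : ℂ), fun h0 => ?_, ?_⟩
    · obtain ⟨u⟩ := ‹Nonempty V›
      exact (hr u).ne' (by simpa using congrFun h0 u)
    · ext u
      have e2 : (∑ w, A u w * r w) = μ * r u := congrFun h u
      simp only [Matrix.mulVec, dotProduct, hB, Matrix.map_apply, Pi.smul_apply, smul_eq_mul]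
      exact_mod_cast e2
  have hrad : spectralRadius ℂ B = (‖(μ : ℂ)‖₊ : ENNReal) := by
    refine le_antisymm (iSup₂_le fun z hz => ?_) (le_iSup₂ (f := fun k _ => (‖k‖₊ : ENNReal)) _ hmem)
    rw [ENNReal.coe_le_coe, ← NNReal.coe_le_coe]
    simpa [abs_of_nonneg hμ] using hle z hz
  rw [matrixSpectralRadius, hrad]
  simp [abs_of_nonneg hμ]

/-- The larger root of `μ² - (s² + 1)(w + 1) μ + w (s² - 1)²`. -/
noncomputable def perronRoot (s w : ℝ) : ℝ :=
  1 / 2 * ((s ^ 2 + 1) * (w + 1) + √((s ^ 2 + 1) ^ 2 * (1 - w) ^ 2 + 16 * s ^ 2 * w))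

/-- On vectors constant on diagonal and on off-diagonal vertices, `A` acts as the 2 × 2 matrix with
rows `(1 + s², 2sw)` and `(2s, w(1 + s²))`; this is its characteristic equation. -/
theorem perronRoot_sq {s w : ℝ} (hw : 0 ≤ w) :
    perronRoot s w ^ 2 = (s ^ 2 + 1) * (w + 1) * perronRoot s w - w * (s ^ 2 - 1) ^ 2 := by
  have h := Real.sq_sqrt
    (show 0 ≤ (s ^ 2 + 1) ^ 2 * (1 - w) ^ 2 + 16 * s ^ 2 * w by positivity)
  rw [perronRoot]
  linear_combination h / 4

theorem le_perronRoot {s w : ℝ} (hw : 0 ≤ w) : s ^ 2 + 1 ≤ perronRoot s w := by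
  have h : (s ^ 2 + 1) * (1 - w) ≤
      √((s ^ 2 + 1) ^ 2 * (1 - w) ^ 2 + 16 * s ^ 2 * w) := by
    apply Real.le_sqrt_of_sq_le
    nlinarith [mul_nonneg (sq_nonneg s) hw]
  rw [perronRoot]
  linarith

theorem lt_perronRoot {s w : ℝ} (hs : 0 < s) (hw : 0 < w) : w * (s ^ 2 + 1) < perronRoot s w := by
  have h : (s ^ 2 + 1) * (w - 1) <
      √((s ^ 2 + 1) ^ 2 * (1 - w) ^ 2 + 16 * s ^ 2 * w) := by
    apply Real.lt_sqrt_of_sq_lt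
    have : 0 < s ^ 2 * w := by positivity
    nlinarith
  rw [perronRoot]
  linarith

theorem perronRoot_pos {s w : ℝ} (hw : 0 ≤ w) : 0 < perronRoot s w :=
  lt_of_lt_of_le (by positivity) (le_perronRoot hw)

theorem continuous_perronRoot : Continuous fun v : ℝ × ℝ => perronRoot v.1 v.2 := by
  unfold perronRoot
  fun_prop

/-- A right eigenvector of `matrixA`, as a function of `s = 2^(-x)` and `w = 2^(-z)`. -/
noncomputable def rightVec (s w : ℝ) (u : Fin 2 × Fin 2) : ℝ :=
  if u.1 = u.2 then perronRoot s w - w * (s ^ 2 + 1) else 2 * s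

/-- A left eigenvector of `matrixA`, as a function of `s = 2^(-x)` and `w = 2^(-z)`. -/
noncomputable def leftVec (s w : ℝ) (u : Fin 2 × Fin 2) : ℝ :=
  if u.1 = u.2 then perronRoot s w - w * (s ^ 2 + 1) else 2 * s * w

theorem rightVec_pos {s w : ℝ} (hs : 0 < s) (hw : 0 < w) (u : Fin 2 × Fin 2) :
    0 < rightVec s w u := by
  rw [rightVec]
  split_ifs
  · exact sub_pos.2 (lt_perronRoot hs hw)
  · positivity

theorem leftVec_pos {s w : ℝ} (hs : 0 < s) (hw : 0 < w) (u : Fin 2 × Fin 2) :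
    0 < leftVec s w u := by
  rw [leftVec]
  split_ifs
  · exact sub_pos.2 (lt_perronRoot hs hw)
  · positivity

theorem labelDist_eq (e : (Fin 2 × Fin 2) × (Fin 2 × Fin 2)) :
    labelDist e = if e.1.2 = e.2.2 then 0 else 1 := by
  obtain ⟨⟨i, j⟩, ⟨k, l⟩⟩ := e
  fin_cases j <;> fin_cases l <;> simp [labelDist, graphG]

theorem dotProduct_phi' (x z : ℝ) (e : (Fin 2 × Fin 2) × (Fin 2 × Fin 2)) :
    ![x, z] ⬝ᵥ phi' e = x * (switchFn e.1 + switchFn e.2) + z * labelDist e := by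
  simp [phi']

theorem matrixA_apply (x z : ℝ) (u v : Fin 2 × Fin 2) :
    matrixA x z u v = (if u.1 = v.1 then 1 else 2 ^ (-x)) * (if u.2 = v.2 then 1 else 2 ^ (-x)) *
      (if v.1 = v.2 then 1 else 2 ^ (-z)) := by
  have h := weightMatrix_edge graphGG phi' ![x, z] ((u.1, v.1), (u.2, v.2))
  change matrixA x z u v = _ at h
  rw [h, dotProduct_phi', labelDist_eq]
  simp only [switchFn]
  have h2 : (0 : ℝ) < 2 := by norm_num
  split_ifs <;> simp [← Real.rpow_add h2] <;> ring_nf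

theorem matrixA_mulVec (x z : ℝ) :
    matrixA x z *ᵥ rightVec (2 ^ (-x)) (2 ^ (-z)) =
      perronRoot (2 ^ (-x)) (2 ^ (-z)) • rightVec (2 ^ (-x)) (2 ^ (-z)) := by
  have hw : (0 : ℝ) ≤ 2 ^ (-z) := by positivity
  have h := perronRoot_sq (s := 2 ^ (-x)) hw
  ext ⟨i, j⟩
  simp only [Matrix.mulVec, dotProduct, matrixA_apply, Fintype.sum_prod_type, Fin.sum_univ_two,
    rightVec, Pi.smul_apply, smul_eq_mul]
  generalize (2 : ℝ) ^ (-x) = s at *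
  generalize (2 : ℝ) ^ (-z) = w at *
  -- Off-diagonal rows hold identically; diagonal rows are the quadratic equation.
  fin_cases i <;> fin_cases j <;> simp <;> first | ring1 | linear_combination -h

theorem vecMul_matrixA (x z : ℝ) :
    leftVec (2 ^ (-x)) (2 ^ (-z)) ᵥ* matrixA x z =
      perronRoot (2 ^ (-x)) (2 ^ (-z)) • leftVec (2 ^ (-x)) (2 ^ (-z)) := by
  have hw : (0 : ℝ) ≤ 2 ^ (-z) := by positivity
  have h := perronRoot_sq (s := 2 ^ (-x)) hw
  ext ⟨i, j⟩
  simp only [Matrix.vecMul, dotProduct, matrixA_apply, Fintype.sum_prod_type, Fin.sum_univ_two,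
    leftVec, Pi.smul_apply, smul_eq_mul]
  generalize (2 : ℝ) ^ (-x) = s at *
  generalize (2 : ℝ) ^ (-z) = w at *
  fin_cases i <;> fin_cases j <;> simp <;> first | ring1 | linear_combination -h

theorem lam_eq_perronRoot (x z : ℝ) : lam x z = perronRoot (2 ^ (-x)) (2 ^ (-z)) :=
  matrixSpectralRadius_eq (weightMatrix_nonneg _ _ _)
    (rightVec_pos (by positivity) (by positivity)) (perronRoot_pos (by positivity)).le
    (matrixA_mulVec x z)

theorem lam_pos (x z : ℝ) : 0 < lam x z := by
  rw [lam_eq_perronRoot]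
  exact perronRoot_pos (by positivity)

theorem lam_eq (x z : ℝ) :
    lam x z =
      1 / 2 * (((4 : ℝ) ^ (-x) + 1) * ((2 : ℝ) ^ (-z) + 1) +
        Real.sqrt (((4 : ℝ) ^ (-x) + 1) ^ 2 * (4 : ℝ) ^ (-z) -
          2 * ((16 : ℝ) ^ (-x) - 6 * (4 : ℝ) ^ (-x) + 1) * (2 : ℝ) ^ (-z) +
          ((4 : ℝ) ^ (-x) + 1) ^ 2)) := by
  have h4 : ∀ y : ℝ, (4 : ℝ) ^ y = (2 ^ y) ^ 2 := fun y => by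
    rw [show (4 : ℝ) = 2 * 2 by norm_num, Real.mul_rpow (by norm_num) (by norm_num), sq]
  have h16 : ∀ y : ℝ, (16 : ℝ) ^ y = (2 ^ y) ^ 4 := fun y => by
    rw [show (16 : ℝ) = 4 * 4 by norm_num, Real.mul_rpow (by norm_num) (by norm_num), h4]
    ring
  rw [lam_eq_perronRoot, perronRoot, h4, h4, h16]
  congr 3
  ring

theorem reindex_matrixA (x z : ℝ) :
    Matrix.reindex finProdFinEquiv finProdFinEquiv (matrixA x z) =
      (!![1, 2 ^ (-x - z), 2 ^ (-x - z), 2 ^ (-2 * x);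
          2 ^ (-x), 2 ^ (-z), 2 ^ (-2 * x - z), 2 ^ (-x);
          2 ^ (-x), 2 ^ (-2 * x - z), 2 ^ (-z), 2 ^ (-x);
          2 ^ (-2 * x), 2 ^ (-x - z), 2 ^ (-x - z), 1] : Matrix (Fin 4) (Fin 4) ℝ) := by
  have h2 : (0 : ℝ) < 2 := by norm_num
  have e0 : (finProdFinEquiv (m := 2) (n := 2)).symm 0 = (0, 0) := by decide
  have e1 : (finProdFinEquiv (m := 2) (n := 2)).symm 1 = (0, 1) := by decide
  have e2 : (finProdFinEquiv (m := 2) (n := 2)).symm 2 = (1, 0) := by decide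
  have e3 : (finProdFinEquiv (m := 2) (n := 2)).symm 3 = (1, 1) := by decide
  have hx : (2 : ℝ) ^ (-2 * x) = 2 ^ (-x) * 2 ^ (-x) := by
    rw [← Real.rpow_add h2]; ring_nf
  have hxz : (2 : ℝ) ^ (-x - z) = 2 ^ (-x) * 2 ^ (-z) := by
    rw [← Real.rpow_add h2]; ring_nf
  have hxxz : (2 : ℝ) ^ (-2 * x - z) = 2 ^ (-x) * 2 ^ (-x) * 2 ^ (-z) := by
    rw [← Real.rpow_add h2, ← Real.rpow_add h2]; ring_nf
  ext i j
  rw [hx, hxz, hxxz, Matrix.reindex_apply, Matrix.submatrix_apply, matrixA_apply]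
  fin_cases i <;> fin_cases j <;> simp [e0, e1, e2, e3]

theorem continuous_lam : Continuous fun v : ℝ × ℝ => lam v.1 v.2 := by
  simp only [lam_eq_perronRoot]
  have h : Continuous fun v : ℝ × ℝ => ((2 : ℝ) ^ (-v.1), (2 : ℝ) ^ (-v.2)) :=
    ((Real.continuous_const_rpow (by norm_num)).comp continuous_fst.neg).prodMk
      ((Real.continuous_const_rpow (by norm_num)).comp continuous_snd.neg)
  exact continuous_perronRoot.comp h

/-! ### The equality chain on `G × G` -/

/-- The stationary chain on `G × G` that attains equality in the duality bound at `(x, z)`. -/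
noncomputable def dualChain (x z : ℝ) : (Fin 2 × Fin 2) × (Fin 2 × Fin 2) → ℝ :=
  perronChain graphGG phi' ![x, z] (leftVec (2 ^ (-x)) (2 ^ (-z)))
    (rightVec (2 ^ (-x)) (2 ^ (-z))) (lam x z)

theorem matrixA_mulVec_lam (x z : ℝ) :
    weightMatrix graphGG phi' ![x, z] *ᵥ rightVec (2 ^ (-x)) (2 ^ (-z)) =
      lam x z • rightVec (2 ^ (-x)) (2 ^ (-z)) := by
  rw [lam_eq_perronRoot]; exact matrixA_mulVec x z

theorem vecMul_matrixA_lam (x z : ℝ) :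
    leftVec (2 ^ (-x)) (2 ^ (-z)) ᵥ* weightMatrix graphGG phi' ![x, z] =
      lam x z • leftVec (2 ^ (-x)) (2 ^ (-z)) := by
  rw [lam_eq_perronRoot]; exact vecMul_matrixA x z

theorem dotProduct_two (x z : ℝ) (v : Fin 2 → ℝ) : ![x, z] ⬝ᵥ v = x * v 0 + z * v 1 := by
  simp [dotProduct, Fin.sum_univ_two]

theorem isStationaryChain_dualChain (x z : ℝ) : IsStationaryChain graphGG (dualChain x z) :=
  isStationaryChain_perronChain (leftVec_pos (by positivity) (by positivity))
    (rightVec_pos (by positivity) (by positivity)) (lam_pos x z)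
    (matrixA_mulVec_lam x z) (vecMul_matrixA_lam x z)

theorem condEntropy_dualChain (x z : ℝ) :
    condEntropy graphGG (dualChain x z) =
      x * expect (dualChain x z) phi' 0 + z * expect (dualChain x z) phi' 1 +
        Real.logb 2 (lam x z) := by
  have h := condEntropy_perronChain (leftVec_pos (by positivity) (by positivity))
    (rightVec_pos (by positivity) (by positivity)) (lam_pos x z)
    (matrixA_mulVec_lam x z) (vecMul_matrixA_lam x z)
  rwa [dotProduct_two] at h

theorem IsStationaryChain.condEntropy_le_lam {Q : (Fin 2 × Fin 2) × (Fin 2 × Fin 2) → ℝ}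
    (hQ : IsStationaryChain graphGG Q) (x z : ℝ) :
    condEntropy graphGG Q ≤
      x * expect Q phi' 0 + z * expect Q phi' 1 + Real.logb 2 (lam x z) := by
  have h := hQ.condEntropy_le_logb (rightVec_pos (by positivity) (by positivity)) (lam_pos x z)
    (matrixA_mulVec_lam x z)
  rwa [dotProduct_two] at h

/-- Weak duality at `(x, z)` is applied to the chain that is exact at `(x', z')`. -/
theorem logb_lam_subgradient (x z x' z' : ℝ) :
    Real.logb 2 (lam x' z') + (x - x') * -expect (dualChain x' z') phi' 0 +
      (z - z') * -expect (dualChain x' z') phi' 1 ≤ Real.logb 2 (lam x z) := by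
  have h := (isStationaryChain_dualChain x' z').condEntropy_le_lam x z
  rw [condEntropy_dualChain] at h
  linarith

theorem expect_phi'_zero (Q : (Fin 2 × Fin 2) × (Fin 2 × Fin 2) → ℝ) :
    expect Q phi' 0 = expect Q (fun e => switchFn e.1) + expect Q (fun e => switchFn e.2) := by
  simp [expect, phi', mul_add, Finset.sum_add_distrib]

theorem expect_phi'_one (Q : (Fin 2 × Fin 2) × (Fin 2 × Fin 2) → ℝ) :
    expect Q phi' 1 = expect Q labelDist := by
  simp [expect, phi']

theorem expect_phi (Q : (Fin 2 × Fin 2) × (Fin 2 × Fin 2) → ℝ) :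
    expect Q phi = (expect Q (fun e => switchFn e.1), expect Q (fun e => switchFn e.2),
      expect Q labelDist) := by
  simp [expect, phi, Prod.ext_iff, Prod.fst_sum, Prod.snd_sum]

/-- The weights involve the switch functions only through their sum, and `Δ` is symmetric. -/
theorem dualChain_swap (x z : ℝ) (e : (Fin 2 × Fin 2) × (Fin 2 × Fin 2)) :
    dualChain x z e.swap = dualChain x z e := by
  have hl : ∀ u, leftVec (2 ^ (-x)) (2 ^ (-z)) u.swap = leftVec (2 ^ (-x)) (2 ^ (-z)) u :=
    fun u => by simp [leftVec, eq_comm]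
  have hr : ∀ u, rightVec (2 ^ (-x)) (2 ^ (-z)) u.swap = rightVec (2 ^ (-x)) (2 ^ (-z)) u :=
    fun u => by simp [rightVec, eq_comm]
  have hd : labelDist e.swap = labelDist e := by simp [labelDist_eq, eq_comm]
  have hs : graphGG.src e.swap = (graphGG.src e).swap := rfl
  have ht : graphGG.tgt e.swap = (graphGG.tgt e).swap := rfl
  simp only [dualChain, perronChain, dotProduct_phi', hs, ht, hl, hr, hd, Prod.fst_swap,
    Prod.snd_swap, add_comm (switchFn e.2)]

theorem expect_dualChain_switchFn (x z : ℝ) :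
    expect (dualChain x z) (fun e => switchFn e.2) =
      expect (dualChain x z) (fun e => switchFn e.1) := by
  simp only [expect]
  rw [← (Equiv.prodComm (Fin 2 × Fin 2) (Fin 2 × Fin 2)).sum_comp]
  simp only [Equiv.prodComm_apply, dualChain_swap, Prod.snd_swap]

theorem continuous_dualChain (e : (Fin 2 × Fin 2) × (Fin 2 × Fin 2)) :
    Continuous fun v : ℝ × ℝ => dualChain v.1 v.2 e := by
  have hp : ∀ g : ℝ × ℝ → ℝ, Continuous g → Continuous fun v => (2 : ℝ) ^ (g v) := fun g hg =>
    (Real.continuous_const_rpow (by norm_num)).comp hg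
  have h1 := hp _ (continuous_fst.neg)
  have h2 := hp _ (continuous_snd.neg)
  have hρ : Continuous fun v : ℝ × ℝ => perronRoot (2 ^ (-v.1)) (2 ^ (-v.2)) :=
    continuous_perronRoot.comp (h1.prodMk h2)
  have hl : ∀ u, Continuous fun v : ℝ × ℝ => leftVec (2 ^ (-v.1)) (2 ^ (-v.2)) u := fun u => by
    simp only [leftVec]; split_ifs <;> fun_prop
  have hr : ∀ u, Continuous fun v : ℝ × ℝ => rightVec (2 ^ (-v.1)) (2 ^ (-v.2)) u := fun u => by
    simp only [rightVec]; split_ifs <;> fun_prop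
  have hW := hp (fun v => -(v.1 * (switchFn e.1 + switchFn e.2) + v.2 * labelDist e))
    (by fun_prop)
  have hlr : Continuous fun v : ℝ × ℝ =>
      leftVec (2 ^ (-v.1)) (2 ^ (-v.2)) ⬝ᵥ rightVec (2 ^ (-v.1)) (2 ^ (-v.2)) :=
    continuous_finsetSum _ fun u _ => (hl u).mul (hr u)
  simp only [dualChain, perronChain, dotProduct_phi']
  refine (((hl _).mul hW).mul (hr _)).div (continuous_lam.mul hlr) fun v => ?_
  refine mul_ne_zero (lam_pos _ _).ne' (ne_of_gt ?_)
  exact Finset.sum_pos (fun u _ => mul_pos (leftVec_pos (by positivity) (by positivity) u)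
    (rightVec_pos (by positivity) (by positivity) u)) Finset.univ_nonempty

theorem continuous_expect_dualChain (i : Fin 2) :
    Continuous fun v : ℝ × ℝ => expect (dualChain v.1 v.2) phi' i := by
  simp only [expect, Finset.sum_apply, Pi.smul_apply, smul_eq_mul]
  exact continuous_finsetSum _ fun e _ => (continuous_dualChain e).mul continuous_const

/-! ### Minimising the dual function -/

/-- The Lagrangian dual function for the constraints `E(f⁽¹⁾ + f⁽²⁾) = 2p` and `E(Δ) ≤ δ`. -/
noncomputable def dualFn (p δ x z : ℝ) : ℝ := 2 * p * x + δ * z + Real.logb 2 (lam x z)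

theorem continuous_dualFn (p δ : ℝ) : Continuous fun v : ℝ × ℝ => dualFn p δ v.1 v.2 := by
  have h : Continuous fun v : ℝ × ℝ => Real.logb 2 (lam v.1 v.2) :=
    (continuous_lam.log fun v => (lam_pos v.1 v.2).ne').div_const _
  unfold dualFn
  fun_prop

/-- Coercivity for `p > 0`: `λ ≥ 4^(-x) + 1` gives `log λ ≥ max 0 (-2x)`, and for negative `x` the
slope `2(1 - p)` is at least `2p`. -/
theorem dualFn_ge {p δ : ℝ} (hp : p ∈ Set.Icc (0 : ℝ) (1 / 2)) (x z : ℝ) :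
    2 * p * |x| + δ * z ≤ dualFn p δ x z := by
  have h2 : (0 : ℝ) < 2 := by norm_num
  have h := le_perronRoot (s := (2 : ℝ) ^ (-x)) (w := (2 : ℝ) ^ (-z)) (by positivity)
  rw [← lam_eq_perronRoot] at h
  have h0 : 0 ≤ Real.logb 2 (lam x z) :=
    Real.logb_nonneg (by norm_num) (by linarith [sq_nonneg ((2 : ℝ) ^ (-x))])
  have h1 : -(2 * x) ≤ Real.logb 2 (lam x z) := by
    rw [Real.le_logb_iff_rpow_le (by norm_num) (lam_pos x z)]
    refine le_trans (le_of_eq ?_) ((lt_add_one _).le.trans h)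
    rw [← Real.rpow_natCast, ← Real.rpow_mul h2.le]
    push_cast
    ring_nf
  obtain ⟨hp0, hp1⟩ := hp
  rw [dualFn]
  rcases abs_cases x with ⟨hx, hx'⟩ | ⟨hx, hx'⟩ <;> rw [hx] <;> nlinarith

theorem exists_dualFn_min {p δ : ℝ} (hp : p ∈ Set.Ioc (0 : ℝ) (1 / 2)) (hδ : 0 < δ) :
    ∃ x z : ℝ, 0 ≤ z ∧ ∀ x' z', 0 ≤ z' → dualFn p δ x z ≤ dualFn p δ x' z' := by
  set c := dualFn p δ 0 0 with hc
  have hge := fun x z => dualFn_ge (δ := δ) ⟨hp.1.le, hp.2⟩ x z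
  have hc0 : 0 ≤ c := by simpa using hge 0 0
  have hp0 : 0 < 2 * p := by linarith [hp.1]
  have hcp : 0 ≤ c / (2 * p) := by positivity
  have hcδ : 0 ≤ c / δ := by positivity
  -- Outside this box, and with `z ≥ 0`, the lower bound exceeds the value `c` at the origin.
  have hK : IsCompact (Set.Icc (-(c / (2 * p))) (c / (2 * p)) ×ˢ Set.Icc 0 (c / δ)) :=
    isCompact_Icc.prod isCompact_Icc
  obtain ⟨⟨x, z⟩, hxz, hmin⟩ := hK.exists_isMinOn
    ⟨(0, 0), ⟨⟨by linarith, hcp⟩, ⟨le_rfl, hcδ⟩⟩⟩ (continuous_dualFn p δ).continuousOn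
  refine ⟨x, z, hxz.2.1, fun x' z' hz' => ?_⟩
  by_cases h : (x', z') ∈ Set.Icc (-(c / (2 * p))) (c / (2 * p)) ×ˢ Set.Icc 0 (c / δ)
  · exact hmin h
  · have h0 : dualFn p δ x z ≤ c :=
      hmin (show ((0 : ℝ), (0 : ℝ)) ∈ _ from ⟨⟨by linarith, hcp⟩, ⟨le_rfl, hcδ⟩⟩)
    refine h0.trans (le_trans ?_ (hge x' z'))
    by_contra! hlt
    have hx1 : 0 ≤ 2 * p * |x'| := by positivity
    have hz1 : 0 ≤ δ * z' := by positivity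
    refine h ⟨abs_le.1 ?_, hz', ?_⟩
    · rw [le_div_iff₀ hp0]; linarith
    · rw [le_div_iff₀ hδ]; linarith

theorem nonneg_of_forall_gt {g : ℝ → ℝ} (hg : Continuous g) {a : ℝ} (h : ∀ t > a, 0 ≤ g t) :
    0 ≤ g a :=
  ge_of_tendsto ((hg.tendsto a).mono_left nhdsWithin_le_nhds)
    (Filter.eventually_of_mem (self_mem_nhdsWithin (s := Set.Ioi a)) h)

theorem nonpos_of_forall_lt {g : ℝ → ℝ} (hg : Continuous g) {a b : ℝ} (hab : b < a)
    (h : ∀ t, b < t → t < a → g t ≤ 0) : g a ≤ 0 :=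
  le_of_tendsto ((hg.tendsto a).mono_left nhdsWithin_le_nhds)
    (Filter.eventually_of_mem (Ioo_mem_nhdsLT hab) fun t ht => h t ht.1 ht.2)

/-- The solution of a variational inequality on a half plane. -/
theorem eq_zero_of_variational_ineq {g h : ℝ × ℝ → ℝ} (hg : Continuous g) (hh : Continuous h)
    {x z : ℝ} (hz : 0 ≤ z)
    (key : ∀ x' z', 0 ≤ z' → 0 ≤ g (x', z') * (x' - x) + h (x', z') * (z' - z)) :
    g (x, z) = 0 ∧ 0 ≤ h (x, z) ∧ z * h (x, z) = 0 := by
  have hc0 : Continuous fun t => g (t, z) := hg.comp (by fun_prop)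
  have hc1 : Continuous fun t => h (x, t) := hh.comp (by fun_prop)
  have hx1 : 0 ≤ g (x, z) := nonneg_of_forall_gt hc0 fun t ht => by
    have := key t z hz
    rw [sub_self, mul_zero, add_zero] at this
    exact nonneg_of_mul_nonneg_left this (sub_pos.2 ht)
  have hx2 : g (x, z) ≤ 0 := nonpos_of_forall_lt hc0 (sub_one_lt x) fun t _ ht => by
    have := key t z hz
    rw [sub_self, mul_zero, add_zero] at this
    exact nonpos_of_mul_nonneg_left this (sub_neg.2 ht)
  have hz1 : 0 ≤ h (x, z) := nonneg_of_forall_gt hc1 fun t ht => by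
    have := key x t (hz.trans ht.le)
    rw [sub_self, mul_zero, zero_add] at this
    exact nonneg_of_mul_nonneg_left this (sub_pos.2 ht)
  refine ⟨le_antisymm hx2 hx1, hz1, ?_⟩
  -- Complementary slackness: for `z > 0` the coordinate can also be moved downwards.
  rcases hz.eq_or_lt with rfl | hz'
  · simp
  · have hz2 : h (x, z) ≤ 0 := nonpos_of_forall_lt hc1 hz' fun t h0 ht => by
      have := key x t h0.le
      rw [sub_self, mul_zero, zero_add] at this
      exact nonpos_of_mul_nonneg_left this (sub_neg.2 ht)
    rw [le_antisymm hz2 hz1, mul_zero]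

/-- The first order conditions at a minimum of the dual function. -/
theorem expect_dualChain_of_min {p δ x z : ℝ} (hz : 0 ≤ z)
    (h : ∀ x' z', 0 ≤ z' → dualFn p δ x z ≤ dualFn p δ x' z') :
    expect (dualChain x z) phi' 0 = 2 * p ∧ expect (dualChain x z) phi' 1 ≤ δ ∧
      z * expect (dualChain x z) phi' 1 = z * δ := by
  obtain ⟨h0, h1, h2⟩ := eq_zero_of_variational_ineq
    (g := fun v => 2 * p - expect (dualChain v.1 v.2) phi' 0)
    (h := fun v => δ - expect (dualChain v.1 v.2) phi' 1)
    (continuous_const.sub (continuous_expect_dualChain 0))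
    (continuous_const.sub (continuous_expect_dualChain 1)) (x := x) hz fun x' z' hz' => by
      -- The subgradient is taken at the moved point `(x', z')`; continuity then carries the sign
      -- conditions back to `(x, z)`.
      have h1 := h x' z' hz'
      have h2 := logb_lam_subgradient x z x' z'
      simp only [dualFn] at h1 ⊢
      linarith
  refine ⟨(sub_eq_zero.1 h0).symm, sub_nonneg.1 h1, ?_⟩
  rw [mul_sub] at h2
  exact (sub_eq_zero.1 h2).symm

/-! ### Explicit feasible chains -/

/-- The stationary chain on `G` with switch probability `p`. -/
noncomputable def switchChain (p : ℝ) (e : Fin 2 × Fin 2) : ℝ :=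
  if e.1 = e.2 then (1 - p) / 2 else p / 2

theorem isStationaryChain_switchChain {p : ℝ} (hp : p ∈ Set.Icc (0 : ℝ) 1) :
    IsStationaryChain graphG.toDiGraph (switchChain p) := by
  refine isStationaryChain_of_nonneg (fun e => ?_) ?_ fun u => ?_
  · rw [switchChain]; split_ifs <;> linarith [hp.1, hp.2]
  · simp [switchChain, Fintype.sum_prod_type]; ring
  · simp only [Finset.sum_filter, Fintype.sum_prod_type, Fin.sum_univ_two]
    fin_cases u <;> simp [switchChain, graphG]

theorem expect_switchChain (p : ℝ) : expect (switchChain p) switchFn = p := by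
  simp [expect, switchChain, switchFn, Fintype.sum_prod_type]

/-- The chain on `G × G` whose two components are the same path of `switchChain p`. -/
noncomputable def diagChain (p : ℝ) (e : (Fin 2 × Fin 2) × (Fin 2 × Fin 2)) : ℝ :=
  if e.1 = e.2 then switchChain p e.1 else 0

theorem isStationaryChain_diagChain {p : ℝ} (hp : p ∈ Set.Icc (0 : ℝ) 1) :
    IsStationaryChain graphGG (diagChain p) := by
  have h := isStationaryChain_switchChain hp
  refine isStationaryChain_of_nonneg (fun e => ?_) ?_ fun u => ?_
  · rw [diagChain]; split_ifs
    · exact h.nonneg _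
    · exact le_rfl
  · rw [Fintype.sum_prod_type]
    simpa [diagChain] using h.2.1
  · obtain ⟨i, j⟩ := u
    simp only [Finset.sum_filter, Fintype.sum_prod_type, Fin.sum_univ_two]
    fin_cases i <;> fin_cases j <;> simp [diagChain, switchChain, graphGG, graphG, DiGraph.prod]

theorem expect_diagChain (p : ℝ) : expect (diagChain p) phi = (p, p, 0) := by
  have h := expect_switchChain p
  simp only [expect, smul_eq_mul] at h
  rw [expect_phi]
  simp only [expect, Fintype.sum_prod_type (α₁ := Fin 2 × Fin 2), diagChain, labelDist_eq,
    smul_eq_mul, ite_mul, zero_mul, Finset.sum_ite_eq, Finset.mem_univ, if_true, h, mul_zero,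
    Finset.sum_const_zero]

theorem expect_mix {E M : Type} [Fintype E] [AddCommGroup M] [Module ℝ M] (P Q : E → ℝ)
    (f : E → M) (s t : ℝ) :
    expect (fun e => s * P e + t * Q e) f = s • expect P f + t • expect Q f := by
  simp [expect, add_smul, mul_smul, Finset.sum_add_distrib, Finset.smul_sum]

theorem coe_le_maxEntropy {V E M : Type} [Fintype V] [DecidableEq V] [Fintype E] [AddCommGroup M]
    [Module ℝ M] {G : DiGraph V E} {f : E → M} {U : Set M} {P : E → ℝ} {c : ℝ}
    (hP : P ∈ chains G f U) (h : c ≤ condEntropy G P) : (c : EReal) ≤ maxEntropy G f U :=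
  (EReal.coe_le_coe_iff.2 h).trans
    (le_iSup₂ (f := fun (P : E → ℝ) (_ : P ∈ chains G f U) => (condEntropy G P : EReal)) P hP)

/-! ### Strong duality on `G × G` and the entropy maximum on `G` -/

theorem calG_le (p δ x z : ℝ) (hz : 0 ≤ z) : calG {p} δ ≤ (dualFn p δ x z : EReal) := by
  refine iSup₂_le fun Q hQ => EReal.coe_le_coe_iff.2 ?_
  obtain ⟨hQ, h⟩ := hQ
  rw [expect_phi] at h
  obtain ⟨h1, h2, h3⟩ := h
  simp only [Set.mem_singleton_iff] at h1 h2
  have key := hQ.condEntropy_le_lam x z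
  rw [expect_phi'_zero, expect_phi'_one, h1, h2] at key
  have := mul_le_mul_of_nonneg_left h3.2.le hz
  rw [dualFn]
  linarith

/-- Mixing in a weight `t` of `diagChain p`, for which `Δ` vanishes, makes `E(Δ) < δ` strict. By
concavity at least `(1 - t) m` of the entropy survives, and `t → 0`. -/
theorem coe_le_calG {p δ m : ℝ} (hp : p ∈ Set.Icc (0 : ℝ) 1) (hδ : 0 < δ)
    {Q : (Fin 2 × Fin 2) × (Fin 2 × Fin 2) → ℝ} (hQ : IsStationaryChain graphGG Q)
    (h1 : expect Q (fun e => switchFn e.1) = p) (h2 : expect Q (fun e => switchFn e.2) = p)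
    (h3 : expect Q labelDist ≤ δ) (hm : condEntropy graphGG Q = m) :
    (m : EReal) ≤ calG {p} δ := by
  have hD := isStationaryChain_diagChain hp
  have hd0 : 0 ≤ expect Q labelDist := by
    refine Finset.sum_nonneg fun e _ => mul_nonneg (hQ.nonneg e) ?_
    rw [labelDist_eq]; split_ifs <;> norm_num
  have key : ∀ t ∈ Set.Ioo (0 : ℝ) 1, (((1 - t) * m : ℝ) : EReal) ≤ calG {p} δ := by
    intro t ht
    have ht' : 0 < 1 - t := sub_pos.2 ht.2
    refine coe_le_maxEntropy (P := fun e => (1 - t) * Q e + t * diagChain p e)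
      ⟨hQ.mix hD ht'.le ht.1.le (by ring), ?_⟩ ?_
    · rw [expect_mix, expect_diagChain, expect_phi, h1, h2]
      simp only [Prod.smul_mk, Prod.mk_add_mk, smul_eq_mul]
      refine ⟨?_, ?_, ?_, ?_⟩
      · simp only [Set.mem_singleton_iff]; ring
      · simp only [Set.mem_singleton_iff]; ring
      · simp only [mul_zero, add_zero]; positivity
      · simp only [mul_zero, add_zero]
        nlinarith [ht.1]
    · have hc := condEntropy_concave (G := graphGG) hQ.nonneg hD.nonneg ht' ht.1
      have := mul_nonneg ht.1.le (condEntropy_nonneg (G := graphGG) hD.nonneg)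
      rw [hm] at hc
      linarith
  have hlim : Filter.Tendsto (fun t : ℝ => (((1 - t) * m : ℝ) : EReal)) (nhdsWithin 0 (Set.Ioi 0))
      (nhds (m : EReal)) := by
    have hcont : Continuous fun t : ℝ => (((1 - t) * m : ℝ) : EReal) :=
      continuous_coe_real_ereal.comp (by fun_prop)
    simpa using (hcont.tendsto 0).mono_left (nhdsWithin_le_nhds (s := Set.Ioi 0))
  exact le_of_tendsto hlim (Filter.eventually_of_mem (Ioo_mem_nhdsGT one_pos) key)

theorem calG_eq {p δ : ℝ} (hp : p ∈ Set.Icc (0 : ℝ) (1 / 2)) (hδ : 0 < δ) :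
    calG {p} δ = ⨅ (x : ℝ) (z ∈ Set.Ici (0 : ℝ)), (dualFn p δ x z : EReal) := by
  have hp1 : p ∈ Set.Icc (0 : ℝ) 1 := ⟨hp.1, hp.2.trans (by norm_num)⟩
  refine le_antisymm (le_iInf fun x => le_iInf₂ fun z hz => calG_le p δ x z hz) ?_
  have hle : ∀ x z : ℝ, 0 ≤ z →
      (⨅ (x : ℝ) (z ∈ Set.Ici (0 : ℝ)), (dualFn p δ x z : EReal)) ≤ (dualFn p δ x z : EReal) :=
    fun x z hz => (iInf_le _ x).trans (iInf₂_le z hz)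
  rcases hp.1.eq_or_lt with rfl | hp0
  -- For `p = 0`, as `x → ∞` with `z = 0`, `λ` tends to `perronRoot 0 1 = 1`, so the dual value
  -- tends to `0`, while entropies are nonnegative.
  · have h0 : ((0 : ℝ) : EReal) ≤ calG {0} δ := by
      refine coe_le_maxEntropy (P := diagChain 0) ⟨isStationaryChain_diagChain hp1, ?_⟩
        (condEntropy_nonneg (isStationaryChain_diagChain hp1).nonneg)
      rw [expect_diagChain]
      exact ⟨rfl, rfl, le_rfl, hδ⟩
    refine le_trans ?_ h0
    have hlim : Filter.Tendsto (fun x : ℝ => (dualFn 0 δ x 0 : EReal)) Filter.atTop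
        (nhds ((0 : ℝ) : EReal)) := by
      have h1 : Filter.Tendsto (fun x : ℝ => ((2 : ℝ) ^ (-x), (1 : ℝ))) Filter.atTop
          (nhds (0, 1)) :=
        ((tendsto_rpow_atBot_of_base_gt_one 2 (by norm_num)).comp
          Filter.tendsto_neg_atTop_atBot).prodMk_nhds tendsto_const_nhds
      have h2 := (continuous_perronRoot.tendsto (0, 1)).comp h1
      have e : perronRoot 0 1 = 1 := by norm_num [perronRoot]
      simp only [e] at h2
      have h3 := (h2.log one_ne_zero).div_const (Real.log 2)
      rw [Real.log_one, zero_div] at h3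
      refine (continuous_coe_real_ereal.tendsto 0).comp (h3.congr fun x => ?_)
      simp [dualFn, lam_eq_perronRoot, Real.logb]
    exact ge_of_tendsto' hlim fun x => hle x 0 le_rfl
  · obtain ⟨x, z, hz, hmin⟩ := exists_dualFn_min ⟨hp0, hp.2⟩ hδ
    obtain ⟨h0, h1, h2⟩ := expect_dualChain_of_min hz hmin
    refine (hle x z hz).trans ?_
    have hc := condEntropy_dualChain x z
    have hs := expect_dualChain_switchFn x z
    -- Complementary slackness replaces `z E(Δ)` by `z δ`, turning the entropy into the dual value.
    rw [h2, h0] at hc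
    rw [expect_phi'_zero] at h0
    rw [expect_phi'_one] at h1
    refine coe_le_calG hp1 hδ (isStationaryChain_dualChain x z) (by linarith) (by linarith) h1 ?_
    rw [hc, dualFn]
    ring

/-- Cross entropy against the kernel that switches with probability `p` depends only on `E(f)`, and
`switchChain p` has this kernel. -/
theorem calF_eq {p : ℝ} (hp : p ∈ Set.Icc (0 : ℝ) (1 / 2)) : calF {p} = (binEnt p : EReal) := by
  have hp1 : p ∈ Set.Icc (0 : ℝ) 1 := ⟨hp.1, hp.2.trans (by norm_num)⟩
  have h1p : 0 < 1 - p := by linarith [hp.2]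
  have hbin : binEnt p = -((1 - p) * Real.logb 2 (1 - p) + p * Real.logb 2 p) := by
    rw [binEnt, Real.binEntropy, Real.log_inv, Real.log_inv, Real.logb, Real.logb]
    ring
  refine le_antisymm (iSup₂_le fun P hP => EReal.coe_le_coe_iff.2 ?_) ?_
  · obtain ⟨hP, h⟩ := hP
    have h1 := hP.2.1
    simp only [expect, switchFn, Set.mem_singleton_iff, Fintype.sum_prod_type,
      Fin.sum_univ_two] at h h1
    simp at h
    have key := condEntropy_le (G := graphG.toDiGraph) hP.nonneg
      (fun u v => if u = v then 1 - p else p)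
      (fun u v => by split_ifs <;> linarith [hp.1])
      (fun u => by fin_cases u <;> simp)
      (fun e he => by
        split_ifs with hc
        · exact h1p.ne'
        -- For `p = 0` the kernel vanishes on switching edges, but `E(f) = 0` forces `P` to vanish
        -- there too.
        · rintro rfl
          have h01 := hP.nonneg (0, 1)
          have h10 := hP.nonneg (1, 0)
          obtain ⟨i, j⟩ := e
          fin_cases i <;> fin_cases j
          · exact hc rfl
          · exact he (le_antisymm (by simpa using (by linarith : P (0, 1) ≤ 0)) h01)
          · exact he (le_antisymm (by simpa using (by linarith : P (1, 0) ≤ 0)) h10)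
          · exact hc rfl)
    refine key.trans (le_of_eq ?_)
    rw [hbin]
    simp only [Fintype.sum_prod_type, Fin.sum_univ_two, graphG]
    simp
    have hs : P (0, 0) + P (1, 1) = 1 - p := by linarith
    linear_combination -Real.logb 2 (1 - p) * hs - Real.logb 2 p * h
  · refine coe_le_maxEntropy (P := switchChain p)
      ⟨isStationaryChain_switchChain hp1, expect_switchChain p⟩ (le_of_eq ?_)
    have hsrc : ∀ u, ∑ e with graphG.src e = u, switchChain p e = 1 / 2 := by
      intro u
      simp only [Finset.sum_filter, Fintype.sum_prod_type, Fin.sum_univ_two]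
      fin_cases u <;> simp [switchChain, graphG] <;> ring
    rw [condEntropy_eq, hbin]
    simp only [hsrc]
    simp [Fintype.sum_prod_type, switchChain]
    ring

end MarkovBound

theorem theorem4 (d δ : ℝ) (hd : d ∈ Set.Icc (0 : ℝ) (1 / 2)) (hδ : δ ∈ Set.Ioc (0 : ℝ) (1 / 2)) :
    RMA d δ =
        (⨆ p ∈ Set.Icc (0 : ℝ) d,
          (((2 * binEnt p : ℝ) : EReal) -
            ⨅ (x : ℝ) (z ∈ Set.Ici (0 : ℝ)),
              ((2 * p * x + δ * z + Real.logb 2 (lam x z) : ℝ) : EReal))) ∧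
      (∀ x z : ℝ,
        Matrix.reindex finProdFinEquiv finProdFinEquiv (matrixA x z) =
          (!![1, 2 ^ (-x - z), 2 ^ (-x - z), 2 ^ (-2 * x);
              2 ^ (-x), 2 ^ (-z), 2 ^ (-2 * x - z), 2 ^ (-x);
              2 ^ (-x), 2 ^ (-2 * x - z), 2 ^ (-z), 2 ^ (-x);
              2 ^ (-2 * x), 2 ^ (-x - z), 2 ^ (-x - z), 1] : Matrix (Fin 4) (Fin 4) ℝ)) ∧
      (∀ x z : ℝ,
        lam x z =
          1 / 2 * (((4 : ℝ) ^ (-x) + 1) * ((2 : ℝ) ^ (-z) + 1) +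
            Real.sqrt (((4 : ℝ) ^ (-x) + 1) ^ 2 * (4 : ℝ) ^ (-z) -
              2 * ((16 : ℝ) ^ (-x) - 6 * (4 : ℝ) ^ (-x) + 1) * (2 : ℝ) ^ (-z) +
              ((4 : ℝ) ^ (-x) + 1) ^ 2))) := by
  refine ⟨biSup_congr fun p hp => ?_, reindex_matrixA, lam_eq⟩
  have hp' : p ∈ Set.Icc (0 : ℝ) (1 / 2) := ⟨hp.1, hp.2.trans hd.2⟩
  rw [calF_eq hp', calG_eq hp' hδ.1, EReal.coe_mul]
  rfl
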